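/- Let $\eta>0$ be fixed and $r=1/(1+\eta)$. There is a constant $C$, depending only on $\eta$, such that for every integer $d\ge 1$ and every $\epsilon$ with $0<\epsilon<1$ there is a straight-line program over $\mathbb C$ (a finite sequence of operations $+,-,\times,\div$, each applied to complex constants, inputs and earlier results) that performs at most $$C\Bigl(\log(d+2)\,\log\log(d+2)+d\,\max\{0,\log\log(1/\epsilon)\}\Bigr)$$ arithmetic operations and has the following property. Let $p=\sum_{i=0}^d p_ix^i$ be any complex polynomial of degree exactly $d$ such that the disc $D(0,r)=\{x\in\mathbb C:|x|\le r\}$ is $(1+\eta)^2$-isolated, that is, $p$ has no root in the annulus $r\le|x|\le(1+\eta)^2r=1+\eta$, and such that $D(0,r)$ contains exactly one root $z$ of $p$, which is simple. Then on the inputs $p_0,\dots,p_d$ the program never divides by zero and outputs a complex number $y$ with $|y-z|\le\epsilon$. (Thus $z$ is approximated within $\epsilon$ by $O(\log d\,\log\log d+d\log\log(1/\epsilon))$ arithmetic operations.) -/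

import Mathlib

/-- The closed disc with centre `X` and radius `r` is `ρ`-isolated for `p`: with `R = ρ * r`,
the polynomial `p` has no root in the closed annulus `r ≤ |x - X| ≤ R`. -/
def IsIsolatedDisc (p : Polynomial ℂ) (X : ℂ) (r ρ : ℝ) : Prop :=
  ∀ x : ℂ, r ≤ ‖x - X‖ → ‖x - X‖ ≤ ρ * r → ¬ p.IsRoot x

/-- The closed disc with centre `X` and radius `r` contains the simple root `z` of `p`
and no other root of `p`. -/
def IsSingleSimpleRootIn (p : Polynomial ℂ) (X : ℂ) (r : ℝ) (z : ℂ) : Prop :=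
  z ∈ Metric.closedBall X r ∧ p.rootMultiplicity z = 1 ∧
    ∀ w ∈ Metric.closedBall X r, p.IsRoot w → w = z

/-- The four arithmetic operations. -/
inductive ArithOp where
  | add
  | sub
  | mul
  | div

/-- An operand: a complex constant of the program, one of the `n` inputs, or the result of the
`j`-th step of the program (steps are numbered from `0`). -/
inductive ArithOperand (n : ℕ) where
  | const (c : ℂ)
  | input (i : Fin n)
  | result (j : ℕ)

/-- One step of a straight-line program: one arithmetic operation on two operands. -/
structure ArithStep (n : ℕ) where
  op : ArithOp
  left : ArithOperand n
  right : ArithOperand n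

/-- A straight-line program over `ℂ` with `n` inputs and one output. -/
structure ArithProgram (n : ℕ) where
  steps : List (ArithStep n)
  output : ArithOperand n

/-- The value of an operation; division by zero is undefined. -/
noncomputable def ArithOp.apply : ArithOp → ℂ → ℂ → Option ℂ
  | .add, a, b => some (a + b)
  | .sub, a, b => some (a - b)
  | .mul, a, b => some (a * b)
  | .div, a, b => if b = 0 then none else some (a / b)

/-- The value of an operand on the inputs `x`, given the list `res` of the results of the steps
made so far; undefined if it refers to a step that has not been made yet. -/
def ArithOperand.value {n : ℕ} (x : Fin n → ℂ) (res : List ℂ) : ArithOperand n → Option ℂ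
  | .const c => some c
  | .input i => some (x i)
  | .result j => res[j]?

/-- The value computed by a step. -/
noncomputable def ArithStep.value {n : ℕ} (x : Fin n → ℂ) (res : List ℂ) (s : ArithStep n) :
    Option ℂ :=
  (s.left.value x res).bind fun a => (s.right.value x res).bind fun b => s.op.apply a b

/-- Starting from the list `res` of earlier results, perform the steps one after the other,
appending each result to the list; undefined as soon as one step is undefined. -/
noncomputable def ArithProgram.exec {n : ℕ} (x : Fin n → ℂ) :
    List (ArithStep n) → List ℂ → Option (List ℂ)
  | [], res => some res
  | s :: t, res => (s.value x res).bind fun v => ArithProgram.exec x t (res ++ [v])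

/-- The output of a program on the inputs `x`, if the execution is defined. -/
noncomputable def ArithProgram.eval {n : ℕ} (P : ArithProgram n) (x : Fin n → ℂ) : Option ℂ :=
  (ArithProgram.exec x P.steps []).bind fun res => P.output.value x res

/-- The number of arithmetic operations performed by a program. -/
def ArithProgram.numOps {n : ℕ} (P : ArithProgram n) : ℕ := P.steps.length

/-! Isolation gives p = g (x - z) Q with Q = ∏ (1 - u x), where the u are the inverses of the other
roots, and |u| ≤ r, |z| ≤ r (`exists_eq_prod_of_isolated`). For z ≠ 0 the power sums of the
reciprocal roots are z^(-j) (1 + Σ (z u)^j), and |z u| ≤ r² < 1, so the quotient of consecutive ones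
tends to z with error O(d r^(2k)) (`norm_quotient_powerSums_le`). To include z = 0, the variable is
scaled by p_0 = -g z: the sums become (-g)^j (1 + Σ (z u)^j), and p_0 times their quotient needs no
division by z (`coeff_neg_derivative_mul_inverse`).

Some k = O(log d) brings the error below any fixed multiple of 1/d. The sums are coefficients of a
logarithmic derivative, found by power series inversion with the FFT in O(k log k) operations
(`Reach.powerSum_quotient`). Since |Q'/Q| ≤ d/η on the unit disc, this approximation already lies
where Newton's iteration converges quadratically (`newton_step`). Each further step costs O(d), and
O(log log(1/ε)) of them suffice.

Programs are handled as computations with functions on the set of admissible inputs, so divisors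
need to be nonzero only there. -/

/-! ### Straight-line computations with functions. -/

/-- `StraightLine S t T`: the functions in `T` are those in `S` together with the results of `t`
arithmetic operations, each applied to functions in `S` and earlier results. -/
inductive StraightLine {X : Type*} : Set (X → ℂ) → ℕ → Set (X → ℂ) → Prop
  | refl (S : Set (X → ℂ)) : StraightLine S 0 S
  | step {S T : Set (X → ℂ)} {t : ℕ} (h : StraightLine S t T) (op : ArithOp) {a b c : X → ℂ}
      (ha : a ∈ T) (hb : b ∈ T) (hc : ∀ x, op.apply (a x) (b x) = some (c x)) :
      StraightLine S (t + 1) (insert c T)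

namespace StraightLine

variable {X : Type*} {S T U : Set (X → ℂ)} {s t : ℕ}

theorem trans (h : StraightLine S s T) (h' : StraightLine T t U) :
    StraightLine S (s + t) U := by
  induction h' with
  | refl => exact h
  | step _ op ha hb hc ih => exact ih.step op ha hb hc

theorem union_right (h : StraightLine S t T) (V : Set (X → ℂ)) :
    StraightLine (S ∪ V) t (T ∪ V) := by
  induction h with
  | refl => exact .refl _
  | step _ op ha hb hc ih =>
    rw [Set.insert_union]
    exact ih.step op (Or.inl ha) (Or.inl hb) hc

theorem subset (h : StraightLine S t T) : S ⊆ T := by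
  induction h with
  | refl => exact subset_rfl
  | step _ op ha hb hc ih => exact ih.trans (Set.subset_insert _ _)

end StraightLine

theorem ArithProgram.exec_append {n : ℕ} (x : Fin n → ℂ) (l l' : List (ArithStep n))
    (res : List ℂ) :
    ArithProgram.exec x (l ++ l') res = (ArithProgram.exec x l res).bind (ArithProgram.exec x l') := by
  induction l generalizing res with
  | nil => rfl
  | cons s l ih =>
    simp only [List.cons_append, ArithProgram.exec]
    cases s.value x res with
    | none => rfl
    | some v => exact ih _

theorem ArithOperand.value_append {n : ℕ} {x : Fin n → ℂ} {res : List ℂ} {o : ArithOperand n}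
    {v : ℂ} (h : o.value x res = some v) (res' : List ℂ) : o.value x (res ++ res') = some v := by
  cases o with
  | const c => exact h
  | input i => exact h
  | result j =>
    simp only [ArithOperand.value] at h ⊢
    rw [List.getElem?_append_left (List.getElem?_eq_some_iff.1 h).1]
    exact h

/-- Each function is tracked by an operand chosen before the point x, so one list of steps serves
all of `X`; only the list of results `r x` varies. -/
theorem StraightLine.exists_steps {X : Type*} {n t : ℕ} {S T : Set (X → ℂ)}
    (h : StraightLine S t T) (inp : X → Fin n → ℂ)
    (hS : ∀ f ∈ S, ∃ o : ArithOperand n, ∀ x, o.value (inp x) [] = some (f x)) :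
    ∃ steps : List (ArithStep n), steps.length = t ∧ ∃ r : X → List ℂ,
      (∀ x, (r x).length = t ∧ ArithProgram.exec (inp x) steps [] = some (r x)) ∧
      ∀ f ∈ T, ∃ o : ArithOperand n, ∀ x, o.value (inp x) (r x) = some (f x) := by
  induction h with
  | refl => exact ⟨[], rfl, fun _ => [], fun x => ⟨rfl, rfl⟩, hS⟩
  | @step T t _ op a b c ha hb hc ih =>
    obtain ⟨steps, hl, r, hr, hT⟩ := ih
    obtain ⟨oa, hoa⟩ := hT a ha
    obtain ⟨ob, hob⟩ := hT b hb
    refine ⟨steps ++ [⟨op, oa, ob⟩], by simp [hl], fun x => r x ++ [c x], fun x => ⟨?_, ?_⟩, ?_⟩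
    · simp [(hr x).1]
    · rw [ArithProgram.exec_append, (hr x).2]
      simp [ArithProgram.exec, ArithStep.value, hoa, hob, hc]
    · rintro f (rfl | hf)
      -- Steps are numbered from 0, so the value computed after `t` steps has index `t`.
      · refine ⟨.result t, fun x => ?_⟩
        simp [ArithOperand.value, (hr x).1]
      · obtain ⟨o, ho⟩ := hT f hf
        exact ⟨o, fun x => ArithOperand.value_append (ho x) _⟩

/-- From the functions in `A` and complex constants one can compute all functions in `B` with at
most `t` arithmetic operations. -/
def Reach {X : Type*} (A : Set (X → ℂ)) (t : ℕ) (B : Set (X → ℂ)) : Prop :=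
  ∃ s ≤ t, ∃ T, StraightLine (A ∪ Set.range (Function.const X)) s T ∧ B ⊆ T

namespace Reach

variable {X : Type*} {A A' B B' C : Set (X → ℂ)} {s t : ℕ} {f g : X → ℂ}

theorem mono (h : Reach A s B) (hA : A ⊆ A') (hst : s ≤ t) (hB : B' ⊆ B) : Reach A' t B' := by
  obtain ⟨u, hu, T, hT, hBT⟩ := h
  refine ⟨u, hu.trans hst, T ∪ (A' ∪ Set.range (Function.const X)), ?_,
    (hB.trans hBT).trans Set.subset_union_left⟩
  have := hT.union_right (A' ∪ Set.range (Function.const X))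
  rwa [Set.union_eq_self_of_subset_left (Set.union_subset_union_left _ hA)] at this

theorem of_subset (h : B ⊆ A) : Reach A 0 B :=
  ⟨0, le_rfl, _, .refl _, h.trans Set.subset_union_left⟩

theorem mem (h : f ∈ A) : Reach A 0 {f} := of_subset (by simpa using h)

theorem const (c : ℂ) : Reach A 0 {Function.const X c} :=
  ⟨0, le_rfl, _, .refl _, by simp⟩

theorem trans (h : Reach A s B) (h' : Reach B t C) : Reach A (s + t) C := by
  obtain ⟨u, hu, T, hT, hBT⟩ := h
  obtain ⟨v, hv, U, hU, hCU⟩ := h'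
  refine ⟨u + v, by omega, U ∪ T, hT.trans ?_, hCU.trans Set.subset_union_left⟩
  have := hU.union_right T
  rwa [Set.union_eq_self_of_subset_left (Set.union_subset hBT
    (Set.subset_union_right.trans hT.subset))] at this

/-- `trans` forgets the starting set; this retains it for later reuse at no cost. -/
theorem keep (h : Reach A t B) : Reach A t (A ∪ B) := by
  obtain ⟨u, hu, T, hT, hBT⟩ := h
  exact ⟨u, hu, T, hT, Set.union_subset (Set.subset_union_left.trans hT.subset) hBT⟩

theorem union (h : Reach A s B) (h' : Reach A t C) : Reach A (s + t) (B ∪ C) :=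
  h.keep.trans ((h'.mono (A' := A ∪ B) Set.subset_union_left le_rfl le_rfl).keep.mono
    subset_rfl le_rfl (Set.union_subset_union_left _ Set.subset_union_right))

theorem image {a : ℕ → X → ℂ} {n : ℕ} (h : ∀ i < n, Reach A t {a i}) :
    Reach A (n * t) (a '' Set.Iio n) := by
  induction n with
  | zero => exact of_subset (by simp) |>.mono subset_rfl (Nat.zero_le _) subset_rfl
  | succ n ih =>
    refine ((ih fun i hi => h i (by omega)).union (h n (by omega))).mono subset_rfl
      (by rw [Nat.succ_mul]) ?_
    rintro _ ⟨i, hi, rfl⟩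
    rcases Nat.lt_succ_iff_lt_or_eq.1 hi with hi | rfl
    · exact Or.inl ⟨i, hi, rfl⟩
    · exact Or.inr rfl

theorem of_op (op : ArithOp) {c : X → ℂ} (hf : Reach A s {f}) (hg : Reach A t {g})
    (hc : ∀ x, op.apply (f x) (g x) = some (c x)) : Reach A (s + t + 1) {c} := by
  refine (hf.union hg).trans ⟨1, le_rfl, _, (StraightLine.refl _).step op (a := f) (b := g)
    ?_ ?_ hc, by simp⟩ <;> simp

theorem add (hf : Reach A s {f}) (hg : Reach A t {g}) : Reach A (s + t + 1) {f + g} :=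
  of_op .add hf hg fun _ => rfl

theorem sub (hf : Reach A s {f}) (hg : Reach A t {g}) : Reach A (s + t + 1) {f - g} :=
  of_op .sub hf hg fun _ => rfl

theorem mul (hf : Reach A s {f}) (hg : Reach A t {g}) : Reach A (s + t + 1) {f * g} :=
  of_op .mul hf hg fun _ => rfl

theorem div (hf : Reach A s {f}) (hg : Reach A t {g}) (h0 : ∀ x, g x ≠ 0) :
    Reach A (s + t + 1) {f / g} :=
  of_op .div hf hg fun x => by simp [ArithOp.apply, h0 x]

theorem smul (c : ℂ) (hf : Reach A s {f}) : Reach A (s + 1) {c • f} :=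
  ((const c).mul hf).mono subset_rfl (by omega) (by
    rw [Set.singleton_subset_iff, Set.mem_singleton_iff]; rfl)

/-- Horner's rule. -/
theorem horner (hx : f ∈ A) (n : ℕ) (a : ℕ → X → ℂ) (ha : ∀ i < n, a i ∈ A) :
    Reach A (2 * n) {∑ i ∈ Finset.range n, a i * f ^ i} := by
  induction n generalizing a with
  | zero => simpa using const (A := A) 0
  | succ n ih =>
    have h := (mem (ha 0 (by omega))).add ((mem hx).mul (ih (fun i => a (i + 1))
      fun i hi => ha _ (by omega)))
    convert h.mono (t := 2 * (n + 1)) subset_rfl (by omega) subset_rfl using 2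
    rw [Finset.sum_range_succ', Finset.mul_sum, add_comm]
    simp only [pow_zero, mul_one]
    congr 1
    exact Finset.sum_congr rfl fun i _ => by ring

theorem exists_program {n : ℕ} {inp : X → Fin n → ℂ}
    (h : Reach (Set.range fun i x => inp x i) t {f}) :
    ∃ P : ArithProgram n, P.numOps ≤ t ∧ ∀ x, P.eval (inp x) = some (f x) := by
  obtain ⟨s, hs, T, hT, hf⟩ := h
  obtain ⟨steps, hl, r, hr, ho⟩ := hT.exists_steps inp (by
    rintro _ (⟨i, rfl⟩ | ⟨c, rfl⟩)
    · exact ⟨.input i, fun x => rfl⟩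
    · exact ⟨.const c, fun x => rfl⟩)
  obtain ⟨o, ho⟩ := ho f (hf rfl)
  refine ⟨⟨steps, o⟩, by simpa [ArithProgram.numOps, hl] using hs, fun x => ?_⟩
  simp [ArithProgram.eval, (hr x).2, ho]

end Reach

/-! ### Fast Fourier transform and power series inversion. -/

open Finset in
theorem sum_range_two_mul {M : Type*} [AddCommMonoid M] (f : ℕ → M) (n : ℕ) :
    ∑ i ∈ range (2 * n), f i = ∑ i ∈ range n, f (2 * i) + ∑ i ∈ range n, f (2 * i + 1) := by
  induction n with
  | zero => simp
  | succ n ih =>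
    rw [show 2 * (n + 1) = 2 * n + 1 + 1 by ring, sum_range_succ, sum_range_succ, ih,
      sum_range_succ, sum_range_succ]
    abel

/-- The inversion formula of the discrete Fourier transform. -/
theorem IsPrimitiveRoot.sum_inv_pow_smul_dft {M : Type*} [AddCommGroup M] [Module ℂ M] {ω : ℂ}
    {n : ℕ} (hω : IsPrimitiveRoot ω n) (a : ℕ → M) {k : ℕ} (hk : k < n) :
    ∑ j ∈ Finset.range n, ω⁻¹ ^ (j * k) • ∑ i ∈ Finset.range n, ω ^ (i * j) • a i
      = (n : ℂ) • a k := by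
  have hω0 : ω ≠ 0 := hω.ne_zero (by omega)
  simp_rw [Finset.smul_sum, smul_smul]
  rw [Finset.sum_comm]
  simp_rw [← Finset.sum_smul]
  rw [Finset.sum_eq_single_of_mem k (Finset.mem_range.2 hk)]
  · congr 1
    have : ∀ j, ω⁻¹ ^ (j * k) * ω ^ (k * j) = 1 := fun j => by
      rw [mul_comm k j, ← mul_pow, inv_mul_cancel₀ hω0, one_pow]
    rw [Finset.sum_congr rfl fun j _ => this j]
    simp
  · intro i hi hik
    -- Off the diagonal the coefficient is a full geometric sum of ω^(i-k), a root of unity other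
    -- than 1.
    convert zero_smul ℂ _
    have h1 : ∀ j, ω⁻¹ ^ (j * k) * ω ^ (i * j) = (ω⁻¹ ^ k * ω ^ i) ^ j := fun j => by
      rw [mul_pow, ← pow_mul, ← pow_mul, mul_comm j k]
    simp_rw [h1]
    have h2 : ω⁻¹ ^ k * ω ^ i ≠ 1 := fun h => hik <| hω.pow_inj (Finset.mem_range.1 hi) hk <| by
      rwa [inv_pow, inv_mul_eq_one₀ (pow_ne_zero _ hω0), eq_comm] at h
    refine (mul_eq_zero.1 (?_ : _ * (ω⁻¹ ^ k * ω ^ i - 1) = 0)).resolve_right (sub_ne_zero.2 h2)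
    rw [geom_sum_mul, mul_pow, ← pow_mul, ← pow_mul, mul_comm k, mul_comm i, pow_mul, pow_mul,
      inv_pow, hω.pow_eq_one]
    simp

namespace Reach

variable {X : Type*}

/-- The fast Fourier transform. -/
theorem dft (m : ℕ) (ω : ℂ) (hω : ω ^ 2 ^ m = 1) (a : ℕ → X → ℂ) :
    Reach (a '' Set.Iio (2 ^ m)) (2 * m * 2 ^ m)
      (Set.range fun j => ∑ i ∈ Finset.range (2 ^ m), ω ^ (i * j) • a i) := by
  induction m generalizing ω a with
  | zero =>
    refine of_subset ?_
    rintro _ ⟨j, rfl⟩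
    exact ⟨0, by simp, by simp⟩
  | succ m ih =>
    have hω2 : (ω ^ 2) ^ 2 ^ m = 1 := by rw [← pow_mul, ← pow_succ', hω]
    have hpow : 2 ^ (m + 1) = 2 * 2 ^ m := pow_succ' 2 m
    have he := (ih (ω ^ 2) hω2 fun i => a (2 * i)).mono (A' := a '' Set.Iio (2 ^ (m + 1))) (by
      rintro _ ⟨i, hi, rfl⟩
      rw [Set.mem_Iio] at hi
      exact ⟨2 * i, by rw [Set.mem_Iio]; omega, rfl⟩) le_rfl subset_rfl
    have ho := (ih (ω ^ 2) hω2 fun i => a (2 * i + 1)).mono (A' := a '' Set.Iio (2 ^ (m + 1))) (by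
      rintro _ ⟨i, hi, rfl⟩
      rw [Set.mem_Iio] at hi
      exact ⟨2 * i + 1, by rw [Set.mem_Iio]; omega, rfl⟩) le_rfl subset_rfl
    refine ((he.union ho).trans (image (n := 2 ^ (m + 1)) (t := 2)
      (a := fun j => ∑ i ∈ Finset.range (2 ^ (m + 1)), ω ^ (i * j) • a i) fun j _ => ?_)).mono
      subset_rfl (le_of_eq (by rw [hpow]; ring)) ?_
    -- The butterfly, with `E` and `O` the transforms of the even and odd terms. They are available
    -- at every index j, so one formula covers both halves at two operations per output.
    · have key : ∀ E O : ℕ → X → ℂ, Reach (Set.range E ∪ Set.range O) 2 {E j + ω ^ j • O j} :=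
        fun E O => (mem (Or.inl (Set.mem_range_self j))).add
          ((mem (Or.inr (Set.mem_range_self j))).smul (ω ^ j))
      convert key _ _ using 2
      rw [hpow, sum_range_two_mul, Finset.smul_sum]
      congr 1 <;> refine Finset.sum_congr rfl fun i _ => ?_
      · rw [← pow_mul, mul_assoc]
      · rw [smul_smul, ← pow_mul, ← pow_add]
        congr 2
        ring
    · rintro _ ⟨j, rfl⟩
      -- Periodicity in j: only 2^(m+1) outputs are distinct.
      refine ⟨j % 2 ^ (m + 1), Nat.mod_lt _ (by positivity), Finset.sum_congr rfl fun i _ => ?_⟩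
      congr 1
      generalize 2 ^ (m + 1) = N at hω
      conv_rhs => rw [← Nat.div_add_mod j N]
      rw [mul_add, pow_add, mul_left_comm, pow_mul ω N, hω, one_pow, one_mul]

open Polynomial in
/-- Fast multiplication of polynomials. -/
theorem coeff_mul (m : ℕ) (f g : (X → ℂ)[X]) (hf : f.natDegree < 2 ^ m)
    (hg : g.natDegree < 2 ^ m) (hfg : (f * g).natDegree < 2 ^ m) :
    Reach (f.coeff '' Set.Iio (2 ^ m) ∪ g.coeff '' Set.Iio (2 ^ m)) ((6 * m + 2) * 2 ^ m)
      (Set.range (f * g).coeff) := by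
  set N := 2 ^ m with hN
  have hN0 : (N : ℂ) ≠ 0 := by simp [hN]
  obtain ⟨ω, hω⟩ : ∃ ω : ℂ, IsPrimitiveRoot ω N :=
    ⟨_, Complex.isPrimitiveRoot_exp N (by simp [hN])⟩
  have hev : ∀ (p : (X → ℂ)[X]), p.natDegree < N → ∀ j,
      ∑ i ∈ Finset.range N, ω ^ (i * j) • p.coeff i = p.eval (algebraMap ℂ (X → ℂ) (ω ^ j)) := by
    intro p hp j
    rw [eval_eq_sum_range' hp]
    refine Finset.sum_congr rfl fun i _ => ?_
    rw [← map_pow, ← pow_mul, mul_comm i j, Algebra.smul_def, mul_comm]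
  have h1 := (dft m ω hω.pow_eq_one f.coeff).mono
    (Set.subset_union_left (t := g.coeff '' Set.Iio (2 ^ m))) le_rfl subset_rfl
  have h2 := (dft m ω hω.pow_eq_one g.coeff).mono
    (Set.subset_union_right (s := f.coeff '' Set.Iio (2 ^ m))) le_rfl subset_rfl
  rw [← hN] at h1 h2
  simp only [hev f hf] at h1
  simp only [hev g hg] at h2
  -- Evaluate at the powers of ω, multiply pointwise, interpolate: three transforms, N products and
  -- N scalings give (6m + 2)N. The degree bound on `f * g` prevents wrap-around.
  have h3 := (h1.union h2).trans (image (n := N) (t := 1)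
    (a := fun j => (f * g).eval (algebraMap ℂ (X → ℂ) (ω ^ j))) fun j _ => by
      rw [eval_mul]
      exact (mem (Or.inl ⟨j, rfl⟩)).mul (mem (Or.inr ⟨j, rfl⟩)))
  have h4 := h3.trans (dft m ω⁻¹ (by rw [← hN, inv_pow, hω.pow_eq_one, inv_one]) _)
  have h5 := h4.trans (image (n := N) (t := 1) (a := (f * g).coeff) fun k hk => by
    have := (mem (Set.mem_range_self (f := fun k => ∑ j ∈ Finset.range N, ω⁻¹ ^ (j * k) •
        (f * g).eval (algebraMap ℂ (X → ℂ) (ω ^ j))) k)).smul (N : ℂ)⁻¹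
    convert this using 2
    simp only [← hev _ hfg]
    rw [hω.sum_inv_pow_smul_dft _ hk, smul_smul, inv_mul_cancel₀ hN0, one_smul])
  have h6 := (h5.union (const 0)).mono subset_rfl (t := (6 * m + 2) * N) (le_of_eq (by rw [← hN]; ring))
    (B' := Set.range (f * g).coeff) (by
      rintro _ ⟨k, rfl⟩
      rcases lt_or_ge k N with hk | hk
      · exact Or.inl ⟨k, hk, rfl⟩
      · right
        rw [coeff_eq_zero_of_natDegree_lt (hfg.trans_le hk)]
        rfl)
  exact h6

open PowerSeries in
/-- Newton's iteration for the reciprocal of a power series. -/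
theorem coeff_inverse (F G : (X → ℂ)⟦X⟧) (hFG : F * G = 1) (hF : constantCoeff F = 1) (m : ℕ) :
    Reach ((fun i => coeff i F) '' Set.Iio (2 ^ m)) (36 * (m + 1) * 2 ^ m)
      ((fun i => coeff i G) '' Set.Iio (2 ^ m)) := by
  induction m with
  | zero =>
    refine (const (X := X) 1).mono subset_rfl (Nat.zero_le _) ?_
    rintro _ ⟨i, hi, rfl⟩
    have : i = 0 := by simpa using hi
    subst this
    have := congrArg constantCoeff hFG
    rw [map_mul, hF, one_mul, map_one] at this
    simp only [coeff_zero_eq_constantCoeff, this]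
    rfl
  | succ m ih =>
    set A := (fun i => coeff i F) '' Set.Iio (2 ^ (m + 1)) with hA
    have hp1 : 2 ^ (m + 1) = 2 * 2 ^ m := pow_succ' 2 m
    have hp2 : 2 ^ (m + 2) = 4 * 2 ^ m := by ring
    have hpos : 0 < 2 ^ m := by positivity
    have hdeg : ∀ n, 0 < n → ∀ H : (X → ℂ)⟦X⟧, (trunc n H).natDegree < n := by
      intro n hn H
      obtain ⟨n, rfl⟩ := Nat.exists_eq_succ_of_ne_zero hn.ne'
      exact natDegree_trunc_lt H n
    set g := trunc (2 ^ m) G with hg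
    set f := trunc (2 ^ (m + 1)) F with hf
    have dg : g.natDegree < 2 ^ m := hdeg _ hpos G
    have df : f.natDegree < 2 ^ (m + 1) := hdeg _ (by omega) F
    have dgg : (g * g).natDegree < 2 ^ (m + 1) := by
      have := Polynomial.natDegree_mul_le (p := g) (q := g)
      omega
    have dfgg : (f * (g * g)).natDegree < 2 ^ (m + 2) := by
      have := Polynomial.natDegree_mul_le (p := f) (q := g * g)
      omega
    have rG := ih.mono (A' := A) (Set.image_mono (Set.Iio_subset_Iio (by omega))) le_rfl subset_rfl
    have rg : Reach A (36 * (m + 1) * 2 ^ m) (Set.range g.coeff) := by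
      refine ((rG.union (const 0)).mono subset_rfl le_rfl ?_)
      rintro _ ⟨i, rfl⟩
      rw [hg, coeff_trunc]
      split_ifs with hi
      · exact Or.inl ⟨i, hi, rfl⟩
      · exact Or.inr rfl
    have rf : Reach A 0 (Set.range f.coeff) := by
      refine (((of_subset subset_rfl).union (const 0)).mono subset_rfl le_rfl ?_)
      rintro _ ⟨i, rfl⟩
      rw [hf, coeff_trunc]
      split_ifs with hi
      · exact Or.inl ⟨i, hi, rfl⟩
      · exact Or.inr rfl
    have rgg : Reach (Set.range g.coeff) _ (Set.range (g * g).coeff) :=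
      (coeff_mul (m + 1) g g (by omega) (by omega) dgg).mono
        (by simp) le_rfl subset_rfl
    have rfgg : Reach (Set.range f.coeff ∪ Set.range (g * g).coeff) _
        (Set.range (f * (g * g)).coeff) :=
      (coeff_mul (m + 2) f (g * g) (by omega) (by omega) dfgg).mono
        (Set.union_subset_union (Set.image_subset_range _ _) (Set.image_subset_range _ _))
        le_rfl subset_rfl
    have key : ∀ i < 2 ^ (m + 1), coeff i G = (g.coeff i + g.coeff i) - (f * (g * g)).coeff i := by
      obtain ⟨a, ha⟩ : (PowerSeries.X : (X → ℂ)⟦X⟧) ^ 2 ^ m ∣ G - (g : (X → ℂ)⟦X⟧) := by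
        rw [X_pow_dvd_iff]
        intro i hi
        rw [map_sub, Polynomial.coeff_coe, hg, coeff_trunc, if_pos hi, sub_self]
      obtain ⟨b, hb⟩ : (PowerSeries.X : (X → ℂ)⟦X⟧) ^ 2 ^ (m + 1) ∣ F - (f : (X → ℂ)⟦X⟧) := by
        rw [X_pow_dvd_iff]
        intro i hi
        rw [map_sub, Polynomial.coeff_coe, hf, coeff_trunc, if_pos hi, sub_self]
      have hdvd : (PowerSeries.X : (X → ℂ)⟦X⟧) ^ 2 ^ (m + 1) ∣
          G - ((g + g) - f * (g * g) : Polynomial (X → ℂ)) := by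
        -- As F G = 1, G - (2g - F g²) = F (G - g)², so the precision doubles; replacing F by f
        -- changes only terms from 2^(m+1) on.
        refine ⟨F * a ^ 2 - b * (g : (X → ℂ)⟦X⟧) ^ 2, ?_⟩
        push_cast
        have hX : (PowerSeries.X : (X → ℂ)⟦X⟧) ^ 2 ^ (m + 1) = (PowerSeries.X ^ 2 ^ m) ^ 2 := by
          rw [← pow_mul, pow_succ]
        have e1 : (PowerSeries.X ^ 2 ^ (m + 1)) * (F * a ^ 2) = F * (G - (g : (X → ℂ)⟦X⟧)) ^ 2 := by
          rw [ha, hX]; ring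
        have e2 : (PowerSeries.X ^ 2 ^ (m + 1)) * (b * (g : (X → ℂ)⟦X⟧) ^ 2) = (F - (f : (X → ℂ)⟦X⟧)) * (g : (X → ℂ)⟦X⟧) ^ 2 := by
          rw [hb]; ring
        rw [mul_sub, e1, e2]
        linear_combination (2 * (g : (X → ℂ)⟦X⟧) - G) * hFG
      intro i hi
      have := X_pow_dvd_iff.1 hdvd i hi
      rw [map_sub, Polynomial.coeff_coe, sub_eq_zero] at this
      simpa using this
    have r1 := rg.trans (rgg.keep)
    have r2 := (r1.union rf).trans (((rfgg.mono (A' := Set.range g.coeff ∪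
      Set.range (g * g).coeff ∪ Set.range f.coeff) (by
        rintro _ (h | h)
        · exact Or.inr h
        · exact Or.inl (Or.inr h)) le_rfl subset_rfl)).keep)
    refine (r2.trans (image (n := 2 ^ (m + 1)) (t := 2) (a := fun i => coeff i G)
      fun i hi => ?_)).mono subset_rfl ?_ subset_rfl
    · simp only [key i hi]
      exact ((mem (Or.inl (Or.inl (Or.inl ⟨i, rfl⟩)))).add
        (mem (Or.inl (Or.inl (Or.inl ⟨i, rfl⟩))))).sub (mem (Or.inr ⟨i, rfl⟩))
    -- The two products and the final pass cost (36m + 76)·2^m; the bound grows by (36m + 108)·2^m.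
    · rw [hp1, hp2]
      nlinarith
end Reach

/-! ### Power sums of scaled reciprocal roots. -/

section PowerSums

open PowerSeries

/-- The logarithmic derivative of `∏ (1 - a X)` generates the power sums of the `a`. -/
theorem derivative_prod_one_sub (s : Multiset ℂ) :
    derivative ℂ (s.map fun a => 1 - C a * (X : ℂ⟦X⟧)).prod =
      -((s.map fun a => 1 - C a * (X : ℂ⟦X⟧)).prod *
        mk fun k => (s.map fun a => a ^ (k + 1)).sum) := by
  induction s using Multiset.induction with
  | empty =>
    have : (mk fun _ => 0 : ℂ⟦X⟧) = 0 := by ext; simp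
    simp [this]
  | cons a s ih =>
    have h1 : (mk fun k => ((a ::ₘ s).map fun a => a ^ (k + 1)).sum : ℂ⟦X⟧) =
        (mk fun k => a ^ (k + 1)) + mk fun k => (s.map fun a => a ^ (k + 1)).sum := by
      ext k; simp
    have h2 : (1 - C a * (X : ℂ⟦X⟧)) * (mk fun k => a ^ (k + 1)) = C a := by
      ext k
      rw [sub_mul, one_mul, mul_assoc, map_sub, coeff_C_mul, coeff_mk]
      cases k with
      | zero => simp
      | succ k => rw [coeff_succ_X_mul, coeff_mk, coeff_C]; simp; ring
    rw [h1, Multiset.map_cons, Multiset.prod_cons, Derivation.leibniz, ih]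
    have h3 : derivative ℂ (1 - C a * (X : ℂ⟦X⟧)) = -C a := by simp
    rw [h3, smul_eq_mul, smul_eq_mul]
    linear_combination (s.map fun a => 1 - C a * (X : ℂ⟦X⟧)).prod * h2

/-- The power series `p(p₀ X) / p₀`, which makes sense also if `p₀ = 0`. -/
noncomputable def scaledSeries {R : Type*} [CommSemiring R] (c : ℕ → R) : R⟦X⟧ :=
  mk fun i => i.casesOn 1 fun i => c 0 ^ i * c (i + 1)

variable {R : Type*} [CommSemiring R] (c : ℕ → R)

theorem coeff_zero_scaledSeries : coeff 0 (scaledSeries c) = 1 := by simp [scaledSeries]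

theorem coeff_succ_scaledSeries (i : ℕ) :
    coeff (i + 1) (scaledSeries c) = c 0 ^ i * c (i + 1) := by simp [scaledSeries]

/-- Because p_0 = -g z, substituting p_0 X turns g (X - z) into p_0 (1 + g X), so the root z
contributes the number -g, meaningful even when z = 0. -/
theorem scaledSeries_eq_prod {p : Polynomial ℂ} {z g : ℂ} {s : Multiset ℂ}
    (hp : p = Polynomial.C g * ((Polynomial.X - Polynomial.C z) *
      (s.map fun u => 1 - Polynomial.C u * Polynomial.X).prod)) :
    scaledSeries p.coeff =
      ((-g ::ₘ s.map (p.coeff 0 * ·)).map fun a => 1 - C a * (X : ℂ⟦X⟧)).prod := by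
  set Q := (s.map fun u => 1 - Polynomial.C u * Polynomial.X).prod with hQ
  have hQ0 : Q.coeff 0 = 1 := by
    rw [Polynomial.coeff_zero_eq_eval_zero, hQ, Polynomial.eval_multiset_prod, Multiset.map_map]
    simp
  have hp0 : p.coeff 0 = -(g * z) := by
    rw [hp]; simp [Polynomial.mul_coeff_zero, hQ0]
  have hpS (i : ℕ) : p.coeff (i + 1) = g * (Q.coeff i - z * Q.coeff (i + 1)) := by
    rw [hp, Polynomial.coeff_C_mul, sub_mul, Polynomial.coeff_sub, Polynomial.coeff_X_mul,
      Polynomial.coeff_C_mul]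
  have hres : ((s.map (p.coeff 0 * ·)).map fun a => 1 - C a * (X : ℂ⟦X⟧)).prod =
      rescale (p.coeff 0) (Q : ℂ⟦X⟧) := by
    have h := map_multiset_prod ((rescale (p.coeff 0)).comp Polynomial.coeToPowerSeries.ringHom)
      (s.map fun u => 1 - Polynomial.C u * Polynomial.X)
    rw [← hQ] at h
    refine Eq.trans ?_ h.symm
    rw [Multiset.map_map, Multiset.map_map]
    congr 1
    refine Multiset.map_congr rfl fun u _ => ?_
    have hC : rescale (p.coeff 0) (C u) = C u := by
      ext i
      cases i <;> simp [coeff_rescale, coeff_C]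
    simp [hC]
    ring
  rw [Multiset.map_cons, Multiset.prod_cons, hres]
  ext i
  cases i with
  | zero =>
    rw [coeff_zero_scaledSeries]
    rw [coeff_zero_eq_constantCoeff_apply (_ * _), map_mul, ← coeff_zero_eq_constantCoeff_apply
      (rescale _ _), coeff_rescale, Polynomial.coeff_coe, hQ0]
    simp
  | succ i =>
    rw [coeff_succ_scaledSeries, hpS, sub_mul, one_mul, mul_assoc, map_sub, coeff_C_mul,
      coeff_succ_X_mul, coeff_rescale, coeff_rescale, Polynomial.coeff_coe, Polynomial.coeff_coe,
      pow_succ, hp0]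
    ring

/-- The numbers p_0 u equal (-g)(z u), so a power of -g factors out of every power sum. -/
theorem coeff_neg_derivative_mul_inverse {p : Polynomial ℂ} {z g : ℂ} {s : Multiset ℂ}
    (hp : p = Polynomial.C g * ((Polynomial.X - Polynomial.C z) *
      (s.map fun u => 1 - Polynomial.C u * Polynomial.X).prod)) {G : ℂ⟦X⟧}
    (hG : scaledSeries p.coeff * G = 1) (k : ℕ) :
    coeff k (-(derivative ℂ (scaledSeries p.coeff)) * G) =
      (-g) ^ (k + 1) * (1 + (s.map fun u => (z * u) ^ (k + 1)).sum) := by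
  have hp0 : p.coeff 0 = -(g * z) := by
    rw [hp, Polynomial.mul_coeff_zero, Polynomial.mul_coeff_zero,
      Polynomial.coeff_zero_eq_eval_zero (Multiset.prod _), Polynomial.eval_multiset_prod,
      Multiset.map_map]
    simp
  have h := derivative_prod_one_sub (-g ::ₘ s.map (p.coeff 0 * ·))
  rw [← scaledSeries_eq_prod hp] at h
  have h2 : -(derivative ℂ (scaledSeries p.coeff)) * G =
      mk fun k => ((-g ::ₘ s.map (p.coeff 0 * ·)).map fun a => a ^ (k + 1)).sum := by
    rw [h]
    linear_combination (mk fun k =>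
      ((-g ::ₘ s.map (p.coeff 0 * ·)).map fun a => a ^ (k + 1)).sum) * hG
  rw [h2, coeff_mk, Multiset.map_cons, Multiset.sum_cons, Multiset.map_map, mul_add, mul_one,
    ← Multiset.sum_map_mul_left]
  congr 2
  refine Multiset.map_congr rfl fun u _ => ?_
  simp only [Function.comp, hp0]
  rw [← mul_pow]
  congr 1
  ring

end PowerSums

theorem Multiset.norm_sum_map_le {E ι : Type*} [SeminormedAddCommGroup E] (s : Multiset ι)
    (f : ι → E) {b : ℝ} (h : ∀ i ∈ s, ‖f i‖ ≤ b) : ‖(s.map f).sum‖ ≤ Multiset.card s * b := by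
  induction s using Multiset.induction with
  | empty => simp
  | cons a s ih =>
    rw [map_cons, sum_cons, card_cons]
    push_cast
    refine (norm_add_le _ _).trans ?_
    have h1 := h a (by simp)
    have h2 := ih fun i hi => h i (by simp [hi])
    linarith

/-! ### Newton's iteration near the isolated root. -/

section Newton

open Polynomial

/-- The logarithmic derivative is the sum of the terms -u/(1 - u x), each of modulus at most r/(1 -
r) = 1/η, where r = 1/(1 + η). -/
theorem norm_derivative_prod_le {η : ℝ} (hη : 0 < η) {s : Multiset ℂ}
    (hs : ∀ u ∈ s, ‖u‖ ≤ 1 / (1 + η)) {x : ℂ} (hx : ‖x‖ ≤ 1) :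
    (s.map fun u => 1 - C u * X).prod.eval x ≠ 0 ∧
      ‖(derivative (s.map fun u => 1 - C u * X).prod).eval x‖ ≤
        Multiset.card s / η * ‖(s.map fun u => 1 - C u * X).prod.eval x‖ := by
  induction s using Multiset.induction with
  | empty => simp
  | cons u s ih =>
    obtain ⟨h0, hle⟩ := ih fun v hv => hs v (by simp [hv])
    have hu : ‖u‖ ≤ 1 / (1 + η) := hs u (by simp)
    have hux : ‖u * x‖ ≤ 1 / (1 + η) := by
      rw [norm_mul]
      nlinarith [norm_nonneg u, norm_nonneg x]
    have h1 : η / (1 + η) ≤ ‖1 - u * x‖ := by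
      have h2 := norm_sub_norm_le (1 : ℂ) (u * x)
      rw [norm_one] at h2
      have : η / (1 + η) = 1 - 1 / (1 + η) := by field_simp; ring
      linarith
    have h3 : ‖u‖ ≤ 1 / η * ‖1 - u * x‖ := by
      calc ‖u‖ ≤ 1 / (1 + η) := hu
        _ = 1 / η * (η / (1 + η)) := by field_simp
        _ ≤ _ := by gcongr
    have hpos : 0 < ‖1 - u * x‖ := lt_of_lt_of_le (by positivity) h1
    rw [Multiset.map_cons, Multiset.prod_cons, derivative_mul, eval_mul, Multiset.card_cons]
    set Q := (s.map fun u => 1 - C u * X).prod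
    have e1 : (1 - C u * X : ℂ[X]).eval x = 1 - u * x := by simp
    have e2 : (derivative (1 - C u * X : ℂ[X])).eval x = -u := by simp
    rw [eval_add, eval_mul, eval_mul, e1, e2]
    refine ⟨mul_ne_zero (norm_pos_iff.1 hpos) h0, (norm_add_le _ _).trans ?_⟩
    rw [norm_mul, norm_mul, norm_mul, norm_neg]
    have h4 := mul_le_mul_of_nonneg_right h3 (norm_nonneg (Q.eval x))
    have h5 := mul_le_mul_of_nonneg_left hle hpos.le
    push_cast
    calc _ ≤ 1 / η * ‖1 - u * x‖ * ‖Q.eval x‖ +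
          ‖1 - u * x‖ * (Multiset.card s / η * ‖Q.eval x‖) := add_le_add h4 h5
      _ = _ := by ring

/-- One step of Newton's iteration close to a root `z` of `p`. -/
theorem newton_step {η : ℝ} (hη : 0 < η) {p : ℂ[X]} {z g : ℂ} {s : Multiset ℂ}
    (hp : p = C g * ((X - C z) * (s.map fun u => 1 - C u * X).prod)) (hg : g ≠ 0)
    (hs : ∀ u ∈ s, ‖u‖ ≤ 1 / (1 + η)) {x : ℂ} (hx : ‖x‖ ≤ 1) {M : ℝ}
    (hM : Multiset.card s / η ≤ M) (hxM : M * ‖x - z‖ ≤ 1 / 2) :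
    (derivative p).eval x ≠ 0 ∧
      ‖x - p.eval x / (derivative p).eval x - z‖ ≤ 2 * M * ‖x - z‖ ^ 2 := by
  obtain ⟨h0, hle⟩ := norm_derivative_prod_le hη hs hx
  set Q := (s.map fun u => 1 - C u * X).prod
  have e1 : p.eval x = g * ((x - z) * Q.eval x) := by rw [hp]; simp
  have e2 : (derivative p).eval x = g * (Q.eval x + (x - z) * (derivative Q).eval x) := by
    rw [hp]; simp
  have hQ : 0 < ‖Q.eval x‖ := norm_pos_iff.2 h0
  have h1 : ‖(derivative Q).eval x‖ ≤ M * ‖Q.eval x‖ := hle.trans (by gcongr)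
  have h2 : ‖(x - z) * (derivative Q).eval x‖ ≤ 1 / 2 * ‖Q.eval x‖ := by
    rw [norm_mul]
    calc _ ≤ ‖x - z‖ * (M * ‖Q.eval x‖) := by gcongr
      _ = M * ‖x - z‖ * ‖Q.eval x‖ := by ring
      _ ≤ _ := by gcongr
  set D := Q.eval x + (x - z) * (derivative Q).eval x with hD
  have h3 : 1 / 2 * ‖Q.eval x‖ ≤ ‖D‖ := by
    have := norm_sub_le D ((x - z) * (derivative Q).eval x)
    rw [hD, add_sub_cancel_right, ← hD] at this
    linarith
  have hD0 : D ≠ 0 := norm_pos_iff.1 (lt_of_lt_of_le (by positivity) h3)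
  rw [e1, e2]
  refine ⟨mul_ne_zero hg hD0, ?_⟩
  -- The Newton error is exactly (x - z)² Q'/D, where p' = g D and |D| ≥ |Q|/2.
  have e3 : x - g * ((x - z) * Q.eval x) / (g * D) - z =
      (x - z) ^ 2 * (derivative Q).eval x / D := by
    field_simp
    rw [hD]
    ring
  rw [e3, norm_div, norm_mul, norm_pow, div_le_iff₀ (norm_pos_iff.2 hD0)]
  calc _ ≤ ‖x - z‖ ^ 2 * (M * ‖Q.eval x‖) := by gcongr
    _ = 2 * M * ‖x - z‖ ^ 2 * (1 / 2 * ‖Q.eval x‖) := by ring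
    _ ≤ _ := by
      have : 0 ≤ M := le_trans (by positivity) hM
      gcongr

end Newton

/-! ### Factorization from isolation, and the dominant root. -/

section Factorization

open Polynomial

/-- Each other root a has |a| > 1 + η, so X - a = -a (1 - a⁻¹ X) with |a⁻¹| ≤ 1/(1 + η). The factor
X - z is not normalized, since z may be 0. -/
theorem exists_eq_prod_of_isolated {η : ℝ} (hη : 0 < η) {p : ℂ[X]} {z : ℂ}
    (hd : 1 ≤ p.natDegree) (hI : IsIsolatedDisc p 0 (1 / (1 + η)) ((1 + η) ^ 2))
    (hS : IsSingleSimpleRootIn p 0 (1 / (1 + η)) z) :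
    ‖z‖ ≤ 1 / (1 + η) ∧ ∃ (g : ℂ) (s : Multiset ℂ), g ≠ 0 ∧ Multiset.card s ≤ p.natDegree ∧
      (∀ u ∈ s, ‖u‖ ≤ 1 / (1 + η)) ∧
      p = C g * ((X - C z) * (s.map fun u => 1 - C u * X).prod) := by
  obtain ⟨hz, hm, hu⟩ := hS
  have hp0 : p ≠ 0 := by rintro rfl; simp at hd
  have hr : (1 + η) ^ 2 * (1 / (1 + η)) = 1 + η := by field_simp
  rw [mem_closedBall_zero_iff] at hz
  refine ⟨hz, ?_⟩
  have hzr : z ∈ p.roots := by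
    rw [← Multiset.count_pos, count_roots, hm]; exact one_pos
  obtain ⟨t, ht⟩ := Multiset.exists_cons_of_mem hzr
  have hzt : z ∉ t := by
    rw [← Multiset.count_eq_zero]
    have := count_roots p (a := z)
    rw [hm, ht, Multiset.count_cons_self] at this
    omega
  have hta : ∀ a ∈ t, 1 + η < ‖a‖ := by
    intro a ha
    have hroot : p.IsRoot a := (mem_roots hp0).1 (by rw [ht]; simp [ha])
    by_contra! h
    rcases le_or_gt ‖a‖ (1 / (1 + η)) with h' | h'
    · exact hzt (hu a (mem_closedBall_zero_iff.2 h') hroot ▸ ha)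
    · exact hI a (by simpa using h'.le) (by rwa [hr, sub_zero]) hroot
  have hsplit : p = C p.leadingCoeff * (p.roots.map fun a => X - C a).prod :=
    ((IsAlgClosed.splits p).eq_prod_roots)
  have hprod : ∀ t : Multiset ℂ, (∀ a ∈ t, a ≠ 0) → (t.map fun a => X - C a).prod =
      C (t.map fun a => -a).prod * ((t.map fun a => a⁻¹).map fun u => 1 - C u * X).prod := by
    intro t ht
    rw [map_multiset_prod, Multiset.map_map, Multiset.map_map, ← Multiset.prod_map_mul]
    congr 1
    refine Multiset.map_congr rfl fun a ha => ?_
    have : (C a * C a⁻¹ : ℂ[X]) = 1 := by rw [← C_mul, mul_inv_cancel₀ (ht a ha), C_1]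
    simp only [Function.comp, C_neg]
    linear_combination (-X) * this
  have ht0 : ∀ a ∈ t, a ≠ 0 := fun a ha => norm_pos_iff.1 (by linarith [hta a ha])
  refine ⟨p.leadingCoeff * (t.map fun a => -a).prod, t.map fun a => a⁻¹, ?_, ?_, ?_, ?_⟩
  · refine mul_ne_zero (leadingCoeff_ne_zero.2 hp0) (Multiset.prod_ne_zero ?_)
    simpa using fun h => ht0 0 h rfl
  · have := card_roots' p
    rw [ht, Multiset.card_cons] at this
    rw [Multiset.card_map]
    omega
  · intro u hu
    obtain ⟨a, ha, rfl⟩ := Multiset.mem_map.1 hu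
    rw [norm_inv, ← one_div]
    exact one_div_le_one_div_of_le (by linarith) (hta a ha).le
  · conv_lhs => rw [hsplit, ht, Multiset.map_cons, Multiset.prod_cons, hprod t ht0]
    rw [C_mul]
    ring

/-- The quotient of consecutive power sums approximates the dominant root. -/
theorem norm_quotient_powerSums_le {z : ℂ} {s : Multiset ℂ} {ρ : ℝ} {d k : ℕ} (hρ : ρ ≤ 1)
    (hs : ∀ u ∈ s, ‖z * u‖ ≤ ρ) (hρ0 : 0 ≤ ρ) (hd : Multiset.card s ≤ d)
    (hk : d * ρ ^ k ≤ 1 / 2) (hz : ‖z‖ ≤ 1) :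
    1 + (s.map fun u => (z * u) ^ (k + 1)).sum ≠ 0 ∧
    ‖z * (1 + (s.map fun u => (z * u) ^ k).sum) / (1 + (s.map fun u => (z * u) ^ (k + 1)).sum) - z‖
      ≤ 4 * (d * ρ ^ k) := by
  have h : ∀ j, k ≤ j → ‖(s.map fun u => (z * u) ^ j).sum‖ ≤ d * ρ ^ k := by
    intro j hj
    refine (s.norm_sum_map_le _ (b := ρ ^ k) fun u hu => ?_).trans (by gcongr)
    rw [norm_pow]
    exact (pow_le_pow_left₀ (norm_nonneg _) (hs u hu) j).trans (pow_le_pow_of_le_one hρ0 hρ hj)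
  have h1 := h k le_rfl
  have h2 := h (k + 1) (Nat.le_succ k)
  set a := (s.map fun u => (z * u) ^ k).sum
  set b := (s.map fun u => (z * u) ^ (k + 1)).sum
  have h3 : 1 / 2 ≤ ‖1 + b‖ := by
    have := norm_sub_le (1 + b) b
    rw [add_sub_cancel_right, norm_one] at this
    linarith
  have hb0 : 1 + b ≠ 0 := norm_pos_iff.1 (by linarith)
  refine ⟨hb0, ?_⟩
  have e : z * (1 + a) / (1 + b) - z = z * (a - b) / (1 + b) := by field_simp; ring
  rw [e, norm_div, norm_mul, div_le_iff₀ (by linarith)]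
  have h4 : ‖a - b‖ ≤ 2 * (d * ρ ^ k) := (norm_sub_le _ _).trans (by linarith)
  calc ‖z‖ * ‖a - b‖ ≤ 1 * (2 * (d * ρ ^ k)) := by gcongr
    _ = 4 * (d * ρ ^ k) * (1 / 2) := by ring
    _ ≤ _ := by gcongr

end Factorization

/-! ### Operation counts of the two phases. -/

namespace Reach

variable {X : Type*} {A : Set (X → ℂ)}

theorem sum {a : ℕ → X → ℂ} {t n : ℕ} (h : ∀ i < n, Reach A t {a i}) :
    Reach A (n * (t + 1)) {∑ i ∈ Finset.range n, a i} := by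
  induction n with
  | zero => simpa using const (A := A) 0
  | succ n ih =>
    rw [Finset.sum_range_succ]
    exact ((ih fun i hi => h i (by omega)).add (h n (by omega))).mono subset_rfl
      (by rw [Nat.succ_mul]; omega) subset_rfl

theorem powers {f : X → ℂ} (hf : f ∈ A) (n : ℕ) :
    Reach A n ((f ^ ·) '' Set.Iio (n + 1)) := by
  induction n with
  | zero =>
    refine (const 1).mono subset_rfl le_rfl ?_
    rintro _ ⟨i, hi, rfl⟩
    have : i = 0 := by simpa using hi
    subst this
    simp only [pow_zero]
    rfl
  | succ n ih =>
    have h : Reach (A ∪ (f ^ ·) '' Set.Iio (n + 1)) 1 {f ^ n * f} :=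
      (mem (Or.inr ⟨n, Nat.lt_succ_self n, rfl⟩)).mul (mem (Or.inl hf))
    refine (ih.keep.trans h.keep).mono subset_rfl le_rfl ?_
    rintro _ ⟨i, hi, rfl⟩
    rcases Nat.lt_succ_iff_lt_or_eq.1 hi with hi | rfl
    · exact Or.inl (Or.inr ⟨i, hi, rfl⟩)
    · exact Or.inr (pow_succ f n)

open PowerSeries in
/-- Consecutive coefficients of the logarithmic derivative of the scaled series, hence quotients
of consecutive power sums, are computed in quasi-linear time. -/
theorem powerSum_quotient (c : ℕ → X → ℂ) (hc : ∀ i, c i ∈ A) :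
    ∃ T : ℕ → X → ℂ,
      (∀ x, ∃ G : ℂ⟦X⟧, scaledSeries (c · x) * G = 1 ∧
        ∀ j, T j x = coeff j (derivative ℂ (scaledSeries (c · x)) * G)) ∧
      ∀ k m, k + 3 ≤ 2 ^ m → (∀ x, T (k + 1) x ≠ 0) →
        Reach A (46 * ((m + 1) * 2 ^ m)) {c 0 * T k / T (k + 1)} := by
  set F := scaledSeries c with hF
  have hF0 : constantCoeff F = ((1 : (X → ℂ)ˣ) : X → ℂ) := by
    rw [← coeff_zero_eq_constantCoeff_apply, hF, coeff_zero_scaledSeries, Units.val_one]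
  set G := invOfUnit F 1
  have hFG : F * G = 1 := mul_invOfUnit F 1 hF0
  refine ⟨fun j => coeff j (derivative (X → ℂ) F * G), fun x => ?_, fun k m hkm hT => ?_⟩
  · have hFx : map (Pi.evalRingHom (fun _ => ℂ) x) F = scaledSeries (c · x) := by
      ext i
      cases i with
      | zero => rw [coeff_map, hF, coeff_zero_scaledSeries, coeff_zero_scaledSeries, map_one]
      | succ i => rw [coeff_map, hF, coeff_succ_scaledSeries, coeff_succ_scaledSeries]; simp
    have hdF : map (Pi.evalRingHom (fun _ => ℂ) x) (derivative (X → ℂ) F) =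
        derivative ℂ (scaledSeries (c · x)) := by
      rw [← hFx]
      ext i
      simp [coeff_derivative]
    refine ⟨map (Pi.evalRingHom (fun _ => ℂ) x) G, ?_, fun j => ?_⟩
    · rw [← hFx, ← map_mul, hFG, map_one]
    · rw [← hdF, ← map_mul, coeff_map]
      rfl
  · have hN : 1 ≤ 2 ^ m := Nat.one_le_two_pow
    have rF : Reach A (2 * 2 ^ m) ((fun i => coeff i F) '' Set.Iio (2 ^ m)) := by
      refine (((powers (hc 0) (2 ^ m)).keep).trans (image (t := 1) fun i hi => ?_)).mono
        subset_rfl (by omega) subset_rfl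
      cases i with
      | zero =>
        simp only [hF, coeff_zero_scaledSeries]
        exact (const 1).mono subset_rfl (by omega) subset_rfl
      | succ i =>
        simp only [hF, coeff_succ_scaledSeries]
        exact (mem (Or.inr ⟨i, by rw [Set.mem_Iio]; omega, rfl⟩)).mul (mem (Or.inl (hc _)))
    have rFG := rF.trans (coeff_inverse F G hFG hF0 m).keep
    -- Only two coefficients are needed, so direct convolution, linear in j, is cheap enough.
    have hterm : ∀ j < 2 ^ m - 1, Reach ((fun i => coeff i F) '' Set.Iio (2 ^ m) ∪
        (fun i => coeff i G) '' Set.Iio (2 ^ m)) ((j + 1) * 3)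
        {coeff j (derivative (X → ℂ) F * G)} := by
      intro j hj
      rw [PowerSeries.coeff_mul, Finset.Nat.sum_antidiagonal_eq_sum_range_succ_mk]
      refine sum (t := 2) fun i hi => ?_
      simp only [coeff_derivative]
      refine ((mem (Or.inl ⟨i + 1, by rw [Set.mem_Iio]; omega, rfl⟩)).mul
        (const ((i : ℂ) + 1))).mul (mem (Or.inr ⟨j - i, by rw [Set.mem_Iio]; omega, rfl⟩))
    have rT := (hterm k (by omega)).union (hterm (k + 1) (by omega))
    have rall := ((rFG.trans rT).keep).trans (((mem (Or.inl (hc 0))).mul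
      (mem (f := coeff k (derivative (X → ℂ) F * G)) (Or.inr (Or.inl rfl)))).div
      (mem (f := coeff (k + 1) (derivative (X → ℂ) F * G)) (Or.inr (Or.inr rfl))) hT)
    refine rall.mono subset_rfl ?_ subset_rfl
    nlinarith

open Polynomial in
/-- The cost of one step of Newton's iteration. -/
theorem newton_step {d : ℕ} (hd : 1 ≤ d) (p : X → ℂ[X]) (hp : ∀ x, (p x).natDegree = d)
    (hA : ∀ i, (fun x => (p x).coeff i) ∈ A) {y : X → ℂ} (hy : y ∈ A)
    (h0 : ∀ x, (derivative (p x)).eval (y x) ≠ 0) :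
    Reach A (9 * d) {fun x => y x - (p x).eval (y x) / (derivative (p x)).eval (y x)} := by
  have h1 : Reach A (2 * (d + 1)) {fun x => (p x).eval (y x)} := by
    convert horner hy (d + 1) _ (fun i _ => hA i) using 2
    ext x
    rw [eval_eq_sum_range, hp]
    simp
  have h2 : Reach A (d * 1 + 2 * d) {fun x => (derivative (p x)).eval (y x)} := by
    have := (image (A := A) (n := d) (t := 1) (a := fun i x => (p x).coeff (i + 1) * (i + 1))
      fun i _ => (mem (hA (i + 1))).mul (const ((i : ℂ) + 1))).keep.trans
      (horner (Or.inl hy) d _ (fun i hi => Or.inr ⟨i, hi, rfl⟩))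
    convert this using 2
    ext x
    rw [eval_eq_sum_range' (n := d) (by
      have := natDegree_derivative_lt (p := p x) (by rw [hp]; omega)
      rwa [hp] at this)]
    simp [coeff_derivative]
  exact ((mem hy).sub (h1.div h2 h0)).mono subset_rfl (by omega) subset_rfl

end Reach

/-! ### Choice of the parameters. -/

/-- With k about a log(d + 2), ρ^k ≤ (d + 2)^(-2 - |log c|), which absorbs both factors d and the
constant c. The second factor d is there because the Newton region has radius of order 1/d. Additive
constants are absorbed because log log(d + 2) ≥ log log 3 > 0. -/
theorem exists_params {ρ c : ℝ} (hρ0 : 0 < ρ) (hρ : ρ < 1) (hc : 0 < c) :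
    ∃ B : ℝ, ∀ d : ℕ, 1 ≤ d → ∃ k m : ℕ, k + 3 ≤ 2 ^ m ∧ d * (d * ρ ^ k) ≤ c ∧
      ((m + 1 : ℕ) : ℝ) * 2 ^ m ≤ B * (Real.log (d + 2) * Real.log (Real.log (d + 2))) := by
  set l := -Real.log ρ with hl
  have hl0 : 0 < l := neg_pos.2 (Real.log_neg hρ0 hρ)
  set a := (2 + |Real.log c|) / l with ha
  have ha0 : 0 ≤ a := by positivity
  set b := 2 * (a + 4) with hb
  have hb1 : 1 ≤ b := by linarith
  have h3 : 1 < Real.log 3 := by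
    rw [Real.lt_log_iff_exp_lt (by norm_num)]
    exact Real.exp_one_lt_d9.trans (by norm_num)
  set e := Real.log (Real.log 3) with he
  have he0 : 0 < e := Real.log_pos h3
  have hlb : 0 ≤ Real.log b := Real.log_nonneg hb1
  refine ⟨(2 + (2 * Real.log b + 1) / e) * b, fun d hd => ?_⟩
  have hd' : (1 : ℝ) ≤ d := by exact_mod_cast hd
  set L := Real.log (d + 2) with hL
  have hL3 : Real.log 3 ≤ L := Real.log_le_log (by norm_num) (by linarith)
  have hL1 : 1 ≤ L := h3.le.trans hL3
  have hLL : e ≤ Real.log L := Real.log_le_log (by linarith) hL3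
  set k := ⌈a * L⌉₊ with hk
  have hk1 : a * L ≤ k := Nat.le_ceil _
  have hk2 : (k : ℝ) < a * L + 1 := Nat.ceil_lt_add_one (by positivity)
  refine ⟨k, Nat.clog 2 (k + 3), Nat.le_pow_clog one_lt_two _, ?_, ?_⟩
  · have hdL : Real.log d ≤ L := Real.log_le_log (by linarith) (by linarith)
    rw [← Real.log_le_log_iff (by positivity) hc, Real.log_mul (by positivity) (by positivity),
      Real.log_mul (by positivity) (by positivity), Real.log_pow]
    have h1 : l * (a * L) ≤ l * k := by gcongr
    have h2 : l * (a * L) = (2 + |Real.log c|) * L := by rw [ha]; field_simp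
    have h4 : |Real.log c| * 1 ≤ |Real.log c| * L := by gcongr
    have h5 := neg_abs_le (Real.log c)
    have h6 : (k : ℝ) * Real.log ρ = -(l * k) := by rw [hl]; ring
    rw [h6]
    linarith
  · set m := Nat.clog 2 (k + 3) with hm
    have hm2 : (2 : ℝ) ^ m ≤ b * L := by
      have h1 := Nat.pow_pred_clog_lt_self one_lt_two (x := k + 3) (by omega)
      have hm1 : 0 < m := Nat.clog_pos one_lt_two (by omega)
      rw [← hm] at h1
      have h2 : 2 ^ m ≤ 2 * (k + 3) := by
        obtain ⟨j, hj⟩ := Nat.exists_eq_succ_of_ne_zero hm1.ne'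
        rw [hj] at h1 ⊢
        rw [Nat.pred_succ] at h1
        rw [pow_succ]
        omega
      have h4 : (2 : ℝ) ^ m ≤ 2 * (k + 3) := by exact_mod_cast h2
      rw [hb]
      nlinarith
    have hm3 : m * Real.log 2 ≤ Real.log b + Real.log L := by
      rw [← Real.log_pow, ← Real.log_mul (by positivity) (by positivity)]
      exact Real.log_le_log (by positivity) hm2
    have hm4 : (m : ℝ) * (1 / 2) ≤ m * Real.log 2 := by
      have := Real.log_two_gt_d9
      gcongr
      linarith
    have h7 : 2 * Real.log b + 1 ≤ (2 * Real.log b + 1) / e * Real.log L := by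
      rw [div_mul_eq_mul_div, le_div_iff₀ he0]
      gcongr
    have hm5 : ((m + 1 : ℕ) : ℝ) ≤ (2 + (2 * Real.log b + 1) / e) * Real.log L := by
      push_cast
      linarith
    calc _ ≤ (2 + (2 * Real.log b + 1) / e) * Real.log L * (b * L) :=
          mul_le_mul hm5 hm2 (by positivity) (le_trans (by positivity) hm5)
      _ = _ := by ring

/-- The budget may be zero, so accuracy e^(-3) must come without Newton steps. For smaller ε, L =
log log(1/ε) ≥ 1, hence ⌈2L⌉ ≤ 3L; the factor 2 suffices as log 2 > 1/2. -/
theorem exists_newton_steps {ε : ℝ} (hε : 0 < ε) :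
    ∃ n : ℕ, (n : ℝ) ≤ 3 * max 0 (Real.log (Real.log (1 / ε))) ∧
      (Real.exp (-3) ≤ ε ∧ n = 0 ∨ Real.exp (-2 ^ n) ≤ ε) := by
  rcases le_or_gt (Real.exp (-3)) ε with h | h
  · exact ⟨0, by simp, Or.inl ⟨h, rfl⟩⟩
  have h1 : 3 < Real.log (1 / ε) := by
    rw [one_div, Real.log_inv]
    have := (Real.log_lt_iff_lt_exp hε).2 h
    linarith
  set L := Real.log (Real.log (1 / ε)) with hL
  have hL1 : 1 ≤ L := by
    rw [hL, Real.le_log_iff_exp_le (by linarith)]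
    linarith [Real.exp_one_lt_d9]
  refine ⟨⌈2 * L⌉₊, ?_, Or.inr ?_⟩
  · rw [max_eq_right (by linarith)]
    linarith [Nat.ceil_lt_add_one (a := 2 * L) (by linarith)]
  · rw [← Real.le_log_iff_exp_le hε]
    have h2 : Real.log (1 / ε) ≤ 2 ^ ⌈2 * L⌉₊ := by
      rw [← Real.log_le_log_iff (by linarith) (by positivity), Real.log_pow, ← hL]
      have := Real.log_two_gt_d9
      have h3 := Nat.le_ceil (2 * L)
      nlinarith
    rw [one_div, Real.log_inv] at h2
    linarith

/-! ### Assembly of the program. -/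

theorem corollary3 (η : ℝ) (hη : 0 < η) :
    ∃ C : ℝ, ∀ d : ℕ, 1 ≤ d → ∀ ε : ℝ, 0 < ε → ε < 1 →
      ∃ P : ArithProgram (d + 1),
        (P.numOps : ℝ) ≤
          C * (Real.log (d + 2) * Real.log (Real.log (d + 2))
            + d * max 0 (Real.log (Real.log (1 / ε)))) ∧
        ∀ (p : Polynomial ℂ) (z : ℂ), p.natDegree = d →
          IsIsolatedDisc p 0 (1 / (1 + η)) ((1 + η) ^ 2) →
          IsSingleSimpleRootIn p 0 (1 / (1 + η)) z →
          ∃ y : ℂ, P.eval (fun i : Fin (d + 1) => p.coeff i) = some y ∧ ‖y - z‖ ≤ ε := by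
  have hr1 : 1 / (1 + η) < 1 := by rw [div_lt_one (by linarith)]; linarith
  have hr0 : 0 < 1 / (1 + η) := by positivity
  set κ := (1 + η) / η with hκ
  have hκ0 : 0 < κ := by positivity
  have hκ1 : 1 ≤ κ := by rw [hκ, le_div_iff₀ hη]; linarith
  -- The choice of c makes 4 d ρ^k ≤ e^(-3)/(2M) with M = d κ; ρ = r² bounds |z u|.
  obtain ⟨B, hB⟩ := exists_params (ρ := (1 / (1 + η)) ^ 2) (c := Real.exp (-3) / (8 * κ))
    (by positivity) (pow_lt_one₀ hr0.le hr1 (by norm_num)) (by positivity)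
  -- 27 = 3 · 9: at most 3 log log(1/ε) steps of cost 9d.
  refine ⟨max 27 (46 * B), fun d hd ε hε hε1 => ?_⟩
  obtain ⟨k, m, hkm, hk, hcost⟩ := hB d hd
  obtain ⟨n, hn, hnε⟩ := exists_newton_steps hε
  have hd' : (1 : ℝ) ≤ d := by exact_mod_cast hd
  set M := d * κ with hM
  have hM1 : 1 ≤ M := one_le_mul_of_one_le_of_one_le hd' hκ1
  -- The root is carried along for the error analysis only; `inp` depends on the polynomial alone.
  set X := {q : Polynomial ℂ × ℂ // q.1.natDegree = d ∧
    IsIsolatedDisc q.1 0 (1 / (1 + η)) ((1 + η) ^ 2) ∧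
    IsSingleSimpleRootIn q.1 0 (1 / (1 + η)) q.2}
  set p : X → Polynomial ℂ := fun q => q.1.1
  have hfac : ∀ q : X, _ := fun q => exists_eq_prod_of_isolated hη
    (by rw [q.2.1]; exact hd) q.2.2.1 q.2.2.2
  set c : ℕ → X → ℂ := fun i q => (p q).coeff i with hc
  set inp : X → Fin (d + 1) → ℂ := fun q i => (p q).coeff i
  have rc : Reach (Set.range fun i q => inp q i) 0 (Set.range c) := by
    refine ((Reach.of_subset subset_rfl).union (Reach.const 0)).mono subset_rfl le_rfl ?_
    rintro _ ⟨i, rfl⟩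
    rcases Nat.lt_or_ge i (d + 1) with hi | hi
    · exact Or.inl ⟨⟨i, hi⟩, rfl⟩
    · right
      ext q
      exact Polynomial.coeff_eq_zero_of_natDegree_lt (by rw [q.2.1]; omega)
  obtain ⟨T, hT, hTr⟩ := Reach.powerSum_quotient c (A := Set.range c) fun i => ⟨i, rfl⟩
  have hmain : ∀ q : X, T (k + 1) q ≠ 0 ∧
      ‖(c 0 * T k / T (k + 1)) q - q.1.2‖ ≤ Real.exp (-3) / (2 * M) := by
    intro q
    obtain ⟨hz, g, s, hg, hcard, hs, hp⟩ := hfac q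
    rw [q.2.1] at hcard
    obtain ⟨G, hG, hTG⟩ := hT q
    have hTj : ∀ j, T j q = -((-g) ^ (j + 1) *
        (1 + (s.map fun u => (q.1.2 * u) ^ (j + 1)).sum)) := fun j => by
      rw [hTG, ← coeff_neg_derivative_mul_inverse hp hG, neg_mul, map_neg, neg_neg]
    have hsmall : 4 * (d * ((1 / (1 + η)) ^ 2) ^ k) ≤ Real.exp (-3) / (2 * M) := by
      rw [le_div_iff₀ (by positivity)]
      rw [le_div_iff₀ (by positivity)] at hk
      rw [hM]
      linarith
    have hexp : Real.exp (-3) ≤ 1 := Real.exp_le_one_iff.2 (by norm_num)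
    have hle1 : Real.exp (-3) / (2 * M) ≤ 1 := by
      rw [div_le_one (by positivity)]
      linarith
    have hpow : ((1 / (1 + η)) ^ 2) ^ (k + 1) ≤ ((1 / (1 + η)) ^ 2) ^ k :=
      pow_le_pow_of_le_one (by positivity) (pow_le_one₀ hr0.le hr1.le) (Nat.le_succ k)
    have hpow' : d * ((1 / (1 + η)) ^ 2) ^ (k + 1) ≤ d * ((1 / (1 + η)) ^ 2) ^ k := by gcongr
    -- `T j` holds the power sum of exponent j + 1, so the quotient involves exponents k + 1 and k +
    -- 2.
    obtain ⟨hne, hq⟩ := norm_quotient_powerSums_le (z := q.1.2) (s := s)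
      (ρ := (1 / (1 + η)) ^ 2) (d := d) (k := k + 1) (pow_le_one₀ hr0.le hr1.le)
      (fun u hu => (norm_mul _ _).trans_le
        ((mul_le_mul hz (hs u hu) (norm_nonneg _) hr0.le).trans_eq (sq _).symm)) (by positivity) hcard
      (by linarith) (hz.trans hr1.le)
    refine ⟨?_, ?_⟩
    · rw [hTj]
      exact neg_ne_zero.2 (mul_ne_zero (pow_ne_zero _ (neg_ne_zero.2 hg)) hne)
    · have hp0 : c 0 q = -(g * q.1.2) := by
        simp only [hc, p]
        rw [hp, Polynomial.coeff_zero_eq_eval_zero, Polynomial.eval_mul, Polynomial.eval_mul,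
          Polynomial.eval_multiset_prod, Multiset.map_map]
        simp
      have heq : (c 0 * T k / T (k + 1)) q =
          q.1.2 * (1 + (s.map fun u => (q.1.2 * u) ^ (k + 1)).sum) /
            (1 + (s.map fun u => (q.1.2 * u) ^ (k + 1 + 1)).sum) := by
        simp only [Pi.div_apply, Pi.mul_apply]
        rw [hTj, hTj, hp0, div_eq_div_iff (neg_ne_zero.2 (mul_ne_zero
          (pow_ne_zero _ (neg_ne_zero.2 hg)) hne)) hne]
        ring
      rw [heq]
      linarith
  have r0 := rc.trans (Reach.keep (hTr k m hkm fun q => (hmain q).1))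
  set N : (X → ℂ) → X → ℂ := fun y q =>
    y q - (p q).eval (y q) / (Polynomial.derivative (p q)).eval (y q) with hN
  -- The scaled error 2M|y - z| is at most squared by each step.
  have hiter : ∀ j, Reach (Set.range fun i q => inp q i) (46 * ((m + 1) * 2 ^ m) + j * (9 * d))
      (Set.range c ∪ {N^[j] (c 0 * T k / T (k + 1))}) ∧
      ∀ q : X, 2 * M * ‖N^[j] (c 0 * T k / T (k + 1)) q - q.1.2‖ ≤ Real.exp (-2 ^ j) := by
    intro j
    induction j with
    | zero =>
      refine ⟨r0.mono subset_rfl (by omega) subset_rfl, fun q => ?_⟩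
      have := (hmain q).2
      rw [le_div_iff₀ (by positivity)] at this
      rw [Function.iterate_zero, id, mul_comm]
      exact this.trans (Real.exp_le_exp.2 (by norm_num))
    | succ j ih =>
      obtain ⟨ih1, ih2⟩ := ih
      rw [Function.iterate_succ_apply']
      set y := N^[j] (c 0 * T k / T (k + 1))
      have hstep : ∀ q : X, (Polynomial.derivative (p q)).eval (y q) ≠ 0 ∧
          ‖N y q - q.1.2‖ ≤ 2 * M * ‖y q - q.1.2‖ ^ 2 := by
        intro q
        obtain ⟨hz, g, s, hg, hcard, hs, hp⟩ := hfac q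
        rw [q.2.1] at hcard
        have h1 : 2 * M * ‖y q - q.1.2‖ ≤ 1 :=
          (ih2 q).trans (Real.exp_le_one_iff.2 (by simp))
        have hκM : κ ≤ M := by rw [hM]; nlinarith
        -- As η/(1 + η) = 1 - r, this keeps the iterate in the unit disc.
        have h2 : ‖y q - q.1.2‖ ≤ η / (1 + η) := by
          have : η / (1 + η) = 1 / κ := by rw [hκ, one_div_div]
          rw [this, le_div_iff₀ hκ0]
          nlinarith [norm_nonneg (y q - q.1.2)]
        refine newton_step hη hp hg hs ?_ (M := M) ?_ (by linarith)
        · have h3 := norm_add_le (y q - q.1.2) q.1.2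
          rw [sub_add_cancel] at h3
          have h4 : η / (1 + η) + 1 / (1 + η) = 1 := by field_simp; ring
          linarith
        · have : (Multiset.card s : ℝ) ≤ d := by exact_mod_cast hcard
          rw [hM, hκ, div_le_iff₀ hη]
          field_simp
          nlinarith
      refine ⟨?_, fun q => ?_⟩
      · have r := Reach.newton_step hd p (fun q => q.2.1) (A := Set.range c ∪ {y})
          (fun i => Or.inl ⟨i, rfl⟩) (Or.inr rfl) fun q => (hstep q).1
        refine (ih1.trans r.keep).mono subset_rfl (le_of_eq (by ring)) ?_
        exact Set.union_subset_union_left _ Set.subset_union_left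
      · calc _ ≤ 2 * M * (2 * M * ‖y q - q.1.2‖ ^ 2) := by gcongr; exact (hstep q).2
          _ = (2 * M * ‖y q - q.1.2‖) ^ 2 := by ring
          _ ≤ Real.exp (-2 ^ j) ^ 2 := by gcongr; exact ih2 q
          _ = _ := by rw [← Real.exp_nat_mul]; congr 1; push_cast; ring
  obtain ⟨P, hP, hPe⟩ := ((hiter n).1.mono subset_rfl le_rfl
    Set.subset_union_right).exists_program
  refine ⟨P, ?_, fun p' z h1 h2 h3 => ⟨_, hPe ⟨(p', z), h1, h2, h3⟩, ?_⟩⟩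
  · have hP' : (P.numOps : ℝ) ≤ 46 * (((m + 1 : ℕ) : ℝ) * 2 ^ m) + n * (9 * d) := by
      exact_mod_cast hP
    set Q := Real.log (d + 2) * Real.log (Real.log (d + 2)) with hQ
    set E := max 0 (Real.log (Real.log (1 / ε)))
    have hL1 : 1 ≤ Real.log (d + 2) := by
      rw [Real.le_log_iff_exp_le (by positivity)]
      linarith [Real.exp_one_lt_d9]
    have hQ0 : 0 ≤ Q := mul_nonneg (by linarith) (Real.log_nonneg hL1)
    have hE0 : 0 ≤ d * E := mul_nonneg (by linarith) (le_max_left _ _)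
    have e1 : 46 * B * Q ≤ max 27 (46 * B) * Q := by gcongr; exact le_max_right _ _
    have e2 : 27 * (d * E) ≤ max 27 (46 * B) * (d * E) := by gcongr; exact le_max_left _ _
    have e3 : n * (9 * (d : ℝ)) ≤ 3 * E * (9 * d) := by gcongr
    rw [mul_add]
    linarith
  · set q : X := ⟨(p', z), h1, h2, h3⟩
    rcases hnε with ⟨hε3, rfl⟩ | hnε
    · refine ((hmain q).2.trans ?_).trans hε3
      exact div_le_self (Real.exp_pos _).le (by linarith)
    · refine le_trans ?_ hnε
      refine le_trans ?_ ((hiter n).2 q)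
      exact le_mul_of_one_le_left (norm_nonneg _) (by linarith)
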